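/- Let $Z$ and $T$ be first-order theories (sets of sentences, with equality) over a common vocabulary, let $\psi$ be a sentence over it, and let $k\in\mathbb{N}$ (including $0$). Structures have non-empty universes. A non-empty collection $R$ of substructures of a structure $M$ is a \emph{$k$-ary cover} of $M$ if every set of at most $k$ elements of $M$ is contained in a member of $R$; a collection $R$ of substructures of $M$ is a \emph{finitary cover} of $M$ if every finite set of elements of $M$ is contained in a member of $R$. A sentence $\xi$ is an \emph{interpolant between $T$ and $\psi$ modulo $Z$} if $Z\cup T\vdash\xi$ and $Z\vdash(\xi\rightarrow\psi)$. A $\forall^k\exists^*$ sentence consists of exactly $k$ universal quantifiers followed by any finite number (possibly zero) of existential quantifiers and a quantifier-free formula; a $\Pi^0_2$ sentence consists of one or more universal quantifiers followed by one or more existential quantifiers and a quantifier-free formula. (A) The following are equivalent: (1) for every structure $M$ and every $k$-ary cover $R$ of $M$, if $M\models Z$ and $N\models Z\cup T$ for each $N\in R$, then $M\models\psi$; (2) there is a $\forall^k\exists^*$ interpolant $\xi$ between $T$ and $\psi$ modulo $Z$. (B) The following are equivalent: (1) for every structure $M$ and every finitary cover $R$ of $M$, if $M\models Z$ and $N\models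 Z\cup T$ for each $N\in R$, then $M\models\psi$; (2) there is a $\Pi^0_2$ interpolant $\xi$ between $T$ and $\psi$ modulo $Z$. -/

import Mathlib

open scoped FirstOrder

universe u v w

namespace CoveredExtension

open FirstOrder.Language

variable {L : FirstOrder.Language.{u, v}}

/-- A collection `R` of substructures of `M` is a `k`-ary cover of `M`: it is non-empty, and every
set of at most `k` elements of `M` is contained in a member of `R`. As usual in first-order logic,
structures (here: the members of `R`) have non-empty universes; Mathlib's substructures may be
empty, so this is said explicitly. -/
def IsKAryCover {M : Type w} [L.Structure M] (k : ℕ) (R : Set (L.Substructure M)) : Prop :=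
  R.Nonempty ∧ (∀ N ∈ R, (N : Set M).Nonempty) ∧
    ∀ S : Finset M, S.card ≤ k → ∃ N ∈ R, (S : Set M) ⊆ (N : Set M)

/-- A collection `R` of (non-empty) substructures of `M` is a finitary cover of `M`: every finite
set of elements of `M` is contained in a member of `R`. -/
def IsFinitaryCover {M : Type w} [L.Structure M] (R : Set (L.Substructure M)) : Prop :=
  (∀ N ∈ R, (N : Set M).Nonempty) ∧
    ∀ S : Finset M, ∃ N ∈ R, (S : Set M) ⊆ (N : Set M)

/-- `ξ` is a `∀^k ∃^*` sentence: exactly `k` universal quantifiers, followed by any number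
(possibly zero) of existential quantifiers, followed by a quantifier-free formula. -/
def IsForallExists (k : ℕ) (ξ : L.Sentence) : Prop :=
  ∃ φ : L.BoundedFormula Empty k, φ.IsExistential ∧ ξ = φ.alls

/-- `ξ` is a `Π⁰₂` sentence: it is in prenex form, its prefix begins with `∀` and has exactly one
alternation, i.e. it consists of one or more universal quantifiers followed by one or more
existential quantifiers. -/
def IsPiTwo (ξ : L.Sentence) : Prop :=
  ∃ (m : ℕ) (χ : L.BoundedFormula Empty (m + 1 + 1)), χ.IsExistential ∧ ξ = χ.ex.alls

/-- `ξ` is an interpolant between `T` and `ψ` modulo `Z`: `Z` entails `T → ξ` and `ξ → ψ`. -/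
def IsInterpolant (Z T : L.Theory) (ψ ξ : L.Sentence) : Prop :=
  (Z ∪ T) ⊨ᵇ ξ ∧ Z ⊨ᵇ ξ.imp ψ

end CoveredExtension

/-!
Soundness is preservation of existential formulas under extension: in a `k`-ary cover every
`k`-tuple lies in a member, whose witnesses for the existential part also serve in the whole
structure.

For the converse, let `Q` be the class of `∀^k ∃^*` sentences, or that of `Π⁰₂` sentences. Up to
equivalence, `Q` is closed under finite conjunctions, so by compactness, if `Q` contains no
interpolant, there is a model `M` of `Z` and of all consequences of `Z ∪ T` in `Q` in which `ψ`
fails (`exists_model_of_forall_not_isInterpolant`). It remains to replace `M` by an elementarily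
equivalent structure covered by models of `Z ∪ T`. A single ultrapower of `M` does this, with no
chain of extensions and no saturation.

* Let `x` be an `m`-tuple of `M`, and suppose that `M` satisfies the `∀^m ∃^*` consequences of
  `T`. For every finite set `A` of quantifier-free formulas there are a model `N` of `T` and a tuple
  `b` of `N` such that every assignment in `N` of the remaining variables is matched by one in `M`
  with the same truth values on `A` (`exists_modelType_forall_exists_realize_iff`): the finitely
  many patterns of truth values that are not realized over `x` in `M` cannot be unavoidable in
  models of `T`.
* Fix a set `K` of variables of cardinality at least that of the language, and an ultrafilter on the
  finite sets `A` of formulas over `K` that contains every cone. A tuple of the ultrapower has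
  coordinates `x_A`; let `N_A` be chosen for `x_A` and `A`. The ultraproduct of the `N_A` is a model
  of `T`, and by the downward Löwenheim–Skolem theorem the tuple `(b_A)` lies in an elementary
  substructure of it enumerated by `K`. Matching representatives of this enumeration in every `N_A`
  by elements of `M` gives an assignment of `K` in the ultrapower with the same quantifier-free
  formulas true, that is, an embedding of the elementary substructure into the ultrapower which maps
  `(b_A)` to the given tuple (`exists_substructure_ultrapower`).

The sentences in question are handled through the equivalent form `∀ x, ∃ g, Φ (x, g)` with `Φ`
quantifier-free and `g` an assignment of an arbitrary, possibly infinite, set of variables, which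
makes conjunctions and changes of prefix a matter of renaming variables.
-/

universe w'

namespace CoveredExtension

open FirstOrder FirstOrder.Language Filter

variable {L : FirstOrder.Language.{u, v}}

/-! ### Existential formulas as quantifier-free formulas with an existential assignment -/

lemma isQF_toFormula {α : Type*} {n : ℕ} {φ : L.BoundedFormula α n} (h : φ.IsQF) :
    φ.toFormula.IsQF := by
  induction h with
  | falsum => exact .falsum
  | of_isAtomic h =>
    cases h with
    | equal t₁ t₂ => exact .of_isAtomic (.equal _ _)
    | rel R ts => exact .of_isAtomic (.rel _ _)
  | imp _ _ ih₁ ih₂ => exact .imp ih₁ ih₂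

lemma isQF_iInf {α β : Type*} [Finite β] {f : β → L.Formula α} (h : ∀ b, (f b).IsQF) :
    (Formula.iInf f).IsQF := by
  unfold Formula.iInf BoundedFormula.iInf
  dsimp only
  generalize Finset.toList _ = l
  induction l with
  | nil => exact .top
  | cons b l ih => exact (h b).inf ih

lemma isQF_iSup {α β : Type*} [Finite β] {f : β → L.Formula α} (h : ∀ b, (f b).IsQF) :
    (Formula.iSup f).IsQF := by
  unfold Formula.iSup BoundedFormula.iSup
  dsimp only
  generalize Finset.toList _ = l
  induction l with
  | nil => exact BoundedFormula.isQF_bot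
  | cons b l ih => exact (h b).sup ih

lemma realize_congr_of_eqOn {α M : Type*} [DecidableEq α] [L.Structure M] (φ : L.Formula α)
    {x y : α → M} (h : ∀ a ∈ φ.freeVarFinset, x a = y a) : φ.Realize x ↔ φ.Realize y := by
  unfold Formula.Realize
  rw [← BoundedFormula.realize_restrictFreeVar (f := id) (v := fun a => x a) x (fun _ => rfl),
    ← BoundedFormula.realize_restrictFreeVar (f := id) (v := fun a => x a) y
      (fun a => h a a.2)]

lemma exists_isExistential_realize_iff_append {n p : ℕ} {χ : L.BoundedFormula Empty (n + p)}
    (h : χ.IsExistential) :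
    ∃ φ : L.BoundedFormula Empty n, φ.IsExistential ∧
      ∀ (M : Type w) [L.Structure M] (x : Fin n → M),
        φ.Realize default x ↔ ∃ y : Fin p → M, χ.Realize default (Fin.append x y) := by
  induction p with
  | zero =>
    refine ⟨χ, h, fun M _ x => ?_⟩
    have (y : Fin 0 → M) : Fin.append x y = x := by
      rw [Subsingleton.elim y Fin.elim0, Fin.append_elim0]; rfl
    simp [this]
  | succ p ih =>
    obtain ⟨φ, hφ, hr⟩ := ih (χ := BoundedFormula.ex χ) h.ex
    refine ⟨φ, hφ, fun M _ x => ?_⟩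
    simp only [hr, BoundedFormula.realize_ex]
    constructor
    · rintro ⟨y, a, hy⟩
      exact ⟨Fin.snoc y a, by rwa [Fin.append_snoc]⟩
    · rintro ⟨y, hy⟩
      refine ⟨Fin.init y, y (Fin.last p), ?_⟩
      rwa [← Fin.append_snoc, Fin.snoc_init_self]

/-- Only the finitely many variables of `K` that occur in `Φ` need quantifiers. -/
lemma exists_isExistential_of_isQF {K : Type*} {n : ℕ} {Φ : L.Formula (Fin n ⊕ K)}
    (h : Φ.IsQF) :
    ∃ φ : L.BoundedFormula Empty n, φ.IsExistential ∧
      ∀ (M : Type w) [L.Structure M] [Nonempty M] (x : Fin n → M),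
        φ.Realize default x ↔ ∃ g : K → M, Φ.Realize (Sum.elim x g) := by
  classical
  let s : Finset K := Φ.freeVarFinset.toRight
  -- The extra index `Fin.last` receives the variables that do not occur in `Φ`.
  let f : K → Fin s.card.succ := fun k =>
    if hk : k ∈ s then (s.equivFin ⟨k, hk⟩).castSucc else Fin.last _
  have hf : Function.Injective fun k : s => f k := by
    intro a b hab
    simpa [f] using hab
  let r : Fin n ⊕ K → Empty ⊕ Fin (n + s.card.succ) :=
    Sum.elim (fun i => .inr (i.castAdd _)) (fun k => .inr ((f k).natAdd n))
  let χ : L.BoundedFormula Empty (n + s.card.succ) := BoundedFormula.relabel r Φ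
  have hχ : χ.IsQF := h.relabel r
  obtain ⟨φ, hφ, hr⟩ := exists_isExistential_realize_iff_append hχ.isExistential
  have key : ∀ (M : Type w) [L.Structure M] (x : Fin n → M) (y : Fin s.card.succ → M),
      χ.Realize default (Fin.append x y) ↔
        Φ.Realize (Sum.elim x (y ∘ f)) := by
    intro M _ x y
    refine BoundedFormula.realize_relabel.trans ?_
    rw [Formula.Realize]
    have : (Sum.elim default (Fin.append x y ∘ Fin.castAdd 0) ∘ r) = Sum.elim x (y ∘ f) := by
      ext (i | k)
      · exact Fin.append_left x y i
      · exact Fin.append_right x y (f k)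
    rw [this]
    exact iff_of_eq (congrArg _ (Subsingleton.elim _ _))
  refine ⟨φ, hφ, fun M _ _ x => (hr M x).trans ?_⟩
  constructor
  · rintro ⟨y, hy⟩
    exact ⟨y ∘ f, (key M x y).1 hy⟩
  · rintro ⟨g, hg⟩
    refine ⟨Function.extend (fun k : s => f k) (fun k => g k) fun _ => Classical.arbitrary M,
      (key M x _).2 ((realize_congr_of_eqOn Φ ?_).1 hg)⟩
    rintro (i | k) hk
    · rfl
    · exact (hf.extend_apply (fun k : s => g k) (fun _ => Classical.arbitrary M)
        ⟨k, by simpa [s] using hk⟩).symm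

/-- A converse to `exists_isExistential_of_isQF`. With `ℕ` as the set of existential variables, the
number of quantifiers does not have to be recorded. -/
lemma exists_isQF_of_isExistential {n : ℕ} {φ : L.BoundedFormula Empty n}
    (h : φ.IsExistential) :
    ∃ Φ : L.Formula (Fin n ⊕ ℕ), Φ.IsQF ∧
      ∀ (M : Type w) [L.Structure M] [Nonempty M] (x : Fin n → M),
        φ.Realize default x ↔ ∃ g : ℕ → M, Φ.Realize (Sum.elim x g) := by
  induction h with
  | @of_isQF n φ h =>
    refine ⟨φ.toFormula.relabel (Sum.elim Empty.elim Sum.inl),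
      (isQF_toFormula h).relabel _, fun M _ _ x => ?_⟩
    simp only [Formula.realize_relabel, BoundedFormula.realize_toFormula]
    have (g : ℕ → M) : (Sum.elim x g ∘ Sum.elim Empty.elim Sum.inl) ∘ Sum.inl = default :=
      Subsingleton.elim _ _
    simp only [this]
    exact (exists_const (ℕ → M)).symm
  | @ex n φ _ ih =>
    -- The new existential variable becomes the variable `0`, and the old ones are shifted.
    obtain ⟨Φ, hΦ, hr⟩ := ih
    let r : Fin (n + 1) ⊕ ℕ → Fin n ⊕ ℕ :=
      Sum.elim (Fin.lastCases (.inr 0) .inl) (fun k => .inr (k + 1))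
    refine ⟨Φ.relabel r, hΦ.relabel _, fun M _ _ x => ?_⟩
    have key (g : ℕ → M) :
        Sum.elim x g ∘ r = Sum.elim (Fin.snoc x (g 0) : Fin (n + 1) → M) fun k => g (k + 1) := by
      ext (i | k)
      · induction i using Fin.lastCases <;> simp [r]
      · rfl
    simp only [BoundedFormula.realize_ex, hr, Formula.realize_relabel, key]
    constructor
    · rintro ⟨a, g, hg⟩
      exact ⟨fun k => k.casesOn a g, hg⟩
    · rintro ⟨g, hg⟩
      exact ⟨g 0, _, hg⟩

/-! ### The classes of `∀^k ∃^*` and `Π⁰₂` sentences -/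

lemma realize_alls_iff {n : ℕ} (φ : L.BoundedFormula Empty n) (M : Type*) [L.Structure M] :
    M ⊨ φ.alls ↔ ∀ x : Fin n → M, φ.Realize default x :=
  BoundedFormula.realize_alls

lemma exists_isForallExists_of_isQF {K : Type*} {k : ℕ} {Φ : L.Formula (Fin k ⊕ K)}
    (h : Φ.IsQF) :
    ∃ ξ : L.Sentence, IsForallExists k ξ ∧ ∀ (M : Type w) [L.Structure M] [Nonempty M],
      M ⊨ ξ ↔ ∀ x : Fin k → M, ∃ g : K → M, Φ.Realize (Sum.elim x g) := by
  obtain ⟨φ, hφ, hr⟩ := exists_isExistential_of_isQF.{u, v, w} h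
  exact ⟨φ.alls, ⟨φ, hφ, rfl⟩, fun M _ _ => by simp only [realize_alls_iff, hr]⟩

/-- The one existential quantifier that `IsPiTwo` makes explicit is taken to be vacuous, since `Φ`
may have no existential variables at all. -/
lemma exists_isPiTwo_of_isQF {K : Type*} {m : ℕ} {Φ : L.Formula (Fin (m + 1) ⊕ K)}
    (h : Φ.IsQF) :
    ∃ ξ : L.Sentence, IsPiTwo ξ ∧ ∀ (M : Type w) [L.Structure M] [Nonempty M],
      M ⊨ ξ ↔ ∀ x : Fin (m + 1) → M, ∃ g : K → M, Φ.Realize (Sum.elim x g) := by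
  have h' : (Φ.relabel (Sum.map Fin.castSucc id) : L.Formula (Fin (m + 1 + 1) ⊕ K)).IsQF :=
    h.relabel _
  obtain ⟨χ, hχ, hr⟩ := exists_isExistential_of_isQF.{u, v, w} h'
  refine ⟨χ.ex.alls, ⟨m, χ, hχ, rfl⟩, fun M _ _ => ?_⟩
  simp only [realize_alls_iff, BoundedFormula.realize_ex, hr, Formula.realize_relabel,
    Sum.elim_comp_map, Function.comp_id]
  refine forall_congr' fun x => ?_
  have (a : M) : (Fin.snoc x a : Fin (m + 1 + 1) → M) ∘ Fin.castSucc = x := by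
    ext i; simp
  simp [this]

lemma IsForallExists.exists_isQF {k : ℕ} {ξ : L.Sentence} (h : IsForallExists k ξ) :
    ∃ Φ : L.Formula (Fin k ⊕ ℕ), Φ.IsQF ∧ ∀ (M : Type w) [L.Structure M] [Nonempty M],
      M ⊨ ξ ↔ ∀ x : Fin k → M, ∃ g : ℕ → M, Φ.Realize (Sum.elim x g) := by
  obtain ⟨φ, hφ, rfl⟩ := h
  obtain ⟨Φ, hΦ, hr⟩ := exists_isQF_of_isExistential.{u, v, w} hφ
  exact ⟨Φ, hΦ, fun M _ _ => by simp only [realize_alls_iff, hr]⟩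

lemma IsPiTwo.exists_isForallExists {ξ : L.Sentence} (h : IsPiTwo ξ) :
    ∃ m, IsForallExists (m + 1) ξ := by
  obtain ⟨m, χ, hχ, rfl⟩ := h
  exact ⟨m, _, hχ.ex, rfl⟩

/-- The universal quantifiers of both sentences are merged along the injections `ι₁` and `ι₂`, while
the existential variables are kept apart. -/
lemma exists_isQF_inf {k₁ k₂ k : ℕ} {ι₁ : Fin k₁ → Fin k} {ι₂ : Fin k₂ → Fin k}
    (hι₁ : ι₁.Injective) (hι₂ : ι₂.Injective)
    {Φ₁ : L.Formula (Fin k₁ ⊕ ℕ)} {Φ₂ : L.Formula (Fin k₂ ⊕ ℕ)}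
    (h₁ : Φ₁.IsQF) (h₂ : Φ₂.IsQF) :
    ∃ Φ : L.Formula (Fin k ⊕ (ℕ ⊕ ℕ)), Φ.IsQF ∧
      ∀ (M : Type w) [L.Structure M] [Nonempty M],
        (∀ x : Fin k → M, ∃ g, Φ.Realize (Sum.elim x g)) ↔
          (∀ x : Fin k₁ → M, ∃ g, Φ₁.Realize (Sum.elim x g)) ∧
          (∀ x : Fin k₂ → M, ∃ g, Φ₂.Realize (Sum.elim x g)) := by
  refine ⟨Φ₁.relabel (Sum.map ι₁ Sum.inl) ⊓ Φ₂.relabel (Sum.map ι₂ Sum.inr),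
    (h₁.relabel _).inf (h₂.relabel _), fun M _ _ => ?_⟩
  simp only [Formula.realize_inf, Formula.realize_relabel, Sum.elim_comp_map]
  constructor
  · intro h
    constructor
    · intro x
      obtain ⟨y, rfl⟩ := hι₁.surjective_comp_right x
      obtain ⟨g, hg, -⟩ := h y
      exact ⟨_, hg⟩
    · intro x
      obtain ⟨y, rfl⟩ := hι₂.surjective_comp_right x
      obtain ⟨g, -, hg⟩ := h y
      exact ⟨_, hg⟩
  · rintro ⟨h₁, h₂⟩ x
    obtain ⟨g₁, hg₁⟩ := h₁ (x ∘ ι₁)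
    obtain ⟨g₂, hg₂⟩ := h₂ (x ∘ ι₂)
    exact ⟨Sum.elim g₁ g₂, hg₁, hg₂⟩

lemma IsForallExists.exists_inf {k : ℕ} {ξ₁ ξ₂ : L.Sentence} (h₁ : IsForallExists k ξ₁)
    (h₂ : IsForallExists k ξ₂) :
    ∃ ξ : L.Sentence, IsForallExists k ξ ∧ ∀ (M : Type w) [L.Structure M] [Nonempty M],
      M ⊨ ξ ↔ M ⊨ ξ₁ ∧ M ⊨ ξ₂ := by
  obtain ⟨Φ₁, hΦ₁, hr₁⟩ := h₁.exists_isQF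
  obtain ⟨Φ₂, hΦ₂, hr₂⟩ := h₂.exists_isQF
  obtain ⟨Φ, hΦ, hr⟩ := exists_isQF_inf.{u, v, w} Function.injective_id Function.injective_id
    hΦ₁ hΦ₂
  obtain ⟨ξ, hξ, hrξ⟩ := exists_isForallExists_of_isQF hΦ
  exact ⟨ξ, hξ, fun M _ _ => by rw [hrξ, hr, hr₁, hr₂]⟩

lemma IsPiTwo.exists_inf {ξ₁ ξ₂ : L.Sentence} (h₁ : IsPiTwo ξ₁) (h₂ : IsPiTwo ξ₂) :
    ∃ ξ : L.Sentence, IsPiTwo ξ ∧ ∀ (M : Type w) [L.Structure M] [Nonempty M],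
      M ⊨ ξ ↔ M ⊨ ξ₁ ∧ M ⊨ ξ₂ := by
  obtain ⟨m₁, h₁⟩ := h₁.exists_isForallExists
  obtain ⟨m₂, h₂⟩ := h₂.exists_isForallExists
  obtain ⟨Φ₁, hΦ₁, hr₁⟩ := h₁.exists_isQF
  obtain ⟨Φ₂, hΦ₂, hr₂⟩ := h₂.exists_isQF
  obtain ⟨Φ, hΦ, hr⟩ := exists_isQF_inf.{u, v, w} (k := max m₁ m₂ + 1)
    (Fin.castLE_injective (by lia)) (Fin.castLE_injective (by lia)) hΦ₁ hΦ₂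
  obtain ⟨ξ, hξ, hrξ⟩ := exists_isPiTwo_of_isQF hΦ
  exact ⟨ξ, hξ, fun M _ _ => by rw [hrξ, hr, hr₁, hr₂]⟩

lemma exists_isForallExists_top (k : ℕ) :
    ∃ ξ : L.Sentence, IsForallExists k ξ ∧ ∀ (M : Type w) [L.Structure M] [Nonempty M], M ⊨ ξ := by
  obtain ⟨ξ, hξ, hr⟩ := exists_isForallExists_of_isQF (L := L) (K := ℕ) (k := k) .top
  exact ⟨ξ, hξ, fun M _ _ => (hr M).2 fun _ =>
    ⟨fun _ => Classical.arbitrary M, by simp [Formula.Realize]⟩⟩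

lemma exists_isPiTwo_top :
    ∃ ξ : L.Sentence, IsPiTwo ξ ∧ ∀ (M : Type w) [L.Structure M] [Nonempty M], M ⊨ ξ := by
  obtain ⟨ξ, hξ, hr⟩ := exists_isPiTwo_of_isQF (L := L) (K := ℕ) (m := 0) .top
  exact ⟨ξ, hξ, fun M _ _ => (hr M).2 fun _ =>
    ⟨fun _ => Classical.arbitrary M, by simp [Formula.Realize]⟩⟩

lemma IsForallExists.realize_of_cover {k : ℕ} {ξ : L.Sentence} (h : IsForallExists k ξ)
    {M : Type*} [L.Structure M] {R : Set (L.Substructure M)}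
    (hR : ∀ S : Finset M, S.card ≤ k → ∃ N ∈ R, (S : Set M) ⊆ (N : Set M))
    (hN : ∀ N ∈ R, N ⊨ ξ) : M ⊨ ξ := by
  classical
  obtain ⟨φ, hφ, rfl⟩ := h
  rw [realize_alls_iff]
  intro x
  obtain ⟨N, hNR, hxN⟩ := hR (Finset.univ.image x) (Finset.card_image_le.trans (by simp))
  have hx (i : Fin k) : x i ∈ N := hxN (by simp)
  have := hφ.realize_embedding N.subtype
    ((realize_alls_iff φ N).1 (hN N hNR) fun i => ⟨x i, hx i⟩)
  rwa [Subsingleton.elim (N.subtype ∘ (default : Empty → N)) default] at this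

/-- The use of compactness: if `Q` is closed under finite conjunctions up to equivalence, then a
contradiction from `Z`, `¬ψ` and finitely many consequences of `Z ∪ T` in `Q` makes the conjunction
of these consequences an interpolant. -/
lemma exists_model_of_forall_not_isInterpolant {Z T : L.Theory} {ψ : L.Sentence}
    {Q : L.Sentence → Prop}
    (htop : ∃ ξ, Q ξ ∧ ∀ (M : Type (max u v)) [L.Structure M] [Nonempty M], M ⊨ ξ)
    (hinf : ∀ ξ₁ ξ₂, Q ξ₁ → Q ξ₂ → ∃ ξ, Q ξ ∧
      ∀ (M : Type (max u v)) [L.Structure M] [Nonempty M], M ⊨ ξ ↔ M ⊨ ξ₁ ∧ M ⊨ ξ₂)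
    (h : ∀ ξ, Q ξ → ¬ IsInterpolant Z T ψ ξ) :
    ∃ M : Theory.ModelType.{u, v, max u v} Z,
      (∀ ξ, Q ξ → (Z ∪ T) ⊨ᵇ ξ → M ⊨ ξ) ∧ ¬ M ⊨ ψ := by
  classical
  have hconj (F : Finset L.Sentence) : ∃ ξ, Q ξ ∧ (Z ∪ T) ⊨ᵇ ξ ∧
      ∀ (M : Type (max u v)) [L.Structure M] [Nonempty M], M ⊨ ξ →
        ∀ η ∈ F, Q η → (Z ∪ T) ⊨ᵇ η → M ⊨ η := by
    induction F using Finset.induction_on with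
    | empty =>
      obtain ⟨ξ, hξ, hr⟩ := htop
      exact ⟨ξ, hξ, Theory.models_sentence_iff.2 fun M => hr M, by simp⟩
    | insert η F _ ih =>
      obtain ⟨ξ, hξ, hT, hF⟩ := ih
      by_cases hη : Q η ∧ (Z ∪ T) ⊨ᵇ η
      · obtain ⟨ξ', hξ', hr⟩ := hinf ξ η hξ hη.1
        refine ⟨ξ', hξ', Theory.models_sentence_iff.2 fun M => (hr M).2
          ⟨hT.realize_sentence M, hη.2.realize_sentence M⟩, fun M _ _ hM θ hθ => ?_⟩
        rcases Finset.mem_insert.1 hθ with rfl | hθ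
        · exact fun _ _ => ((hr M).1 hM).2
        · exact hF M ((hr M).1 hM).1 θ hθ
      · refine ⟨ξ, hξ, hT, fun M _ _ hM θ hθ => ?_⟩
        rcases Finset.mem_insert.1 hθ with rfl | hθ
        · exact fun h₁ h₂ => (hη ⟨h₁, h₂⟩).elim
        · exact hF M hM θ hθ
  let Γ : L.Theory := Z ∪ {ξ | Q ξ ∧ (Z ∪ T) ⊨ᵇ ξ} ∪ {ψ.not}
  have hΓ : Γ.IsSatisfiable := by
    refine Theory.isSatisfiable_iff_isFinitelySatisfiable.2 fun F hF => ?_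
    obtain ⟨ξ, hξ, hT, hr⟩ := hconj F
    have hZ : ¬ Z ⊨ᵇ ξ.imp ψ := fun hZ => h ξ hξ ⟨hT, hZ⟩
    rw [Theory.models_sentence_iff] at hZ
    push Not at hZ
    obtain ⟨M, hM⟩ := hZ
    rw [Sentence.realize_imp, Classical.not_imp] at hM
    have : M ⊨ (F : L.Theory) := by
      refine ⟨fun θ hθ => ?_⟩
      rcases hF hθ with (hθZ | hθQ) | hθψ
      · exact Theory.realize_sentence_of_mem Z hθZ
      · exact hr M hM.1 θ hθ hθQ.1 hθQ.2
      · rw [Set.mem_singleton_iff.1 hθψ]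
        exact (Sentence.realize_not M).2 hM.2
    exact Theory.Model.isSatisfiable M
  obtain ⟨M⟩ := hΓ
  have hM : M ⊨ Γ := M.is_model
  have : M ⊨ Z := Theory.Model.mono hM fun _ h => .inl (.inl h)
  exact ⟨.of Z M, fun ξ hξ hT => hM.realize_of_mem ξ (.inl (.inr ⟨hξ, hT⟩)),
    (Sentence.realize_not M).1 (hM.realize_of_mem ψ.not (.inr rfl))⟩

/-! ### Ultrapowers covered by models of a theory -/

/-- The downward Löwenheim–Skolem theorem in a form without a lower bound on the size of `P`: the
enumeration by `K` may have repetitions. -/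
lemma exists_elementarySubstructure_eq_range {P : Type w} [L.Structure P] [Nonempty P]
    {K : Type (max u v)} [Infinite K] (hK : L.card ≤ Cardinal.mk K) {s : Set P} (hs : s.Finite) :
    ∃ (S : L.ElementarySubstructure P) (E : K → P), s ⊆ S ∧ Set.range E = S := by
  rcases le_total (Cardinal.lift.{max u v} (Cardinal.mk P)) (Cardinal.lift.{w} (Cardinal.mk K))
    with h | h
  · obtain ⟨f⟩ := Cardinal.lift_mk_le'.1 h
    exact ⟨⊤, Function.invFun f, by simp,
      by simp [(Function.invFun_surjective f.injective).range_eq]⟩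
  · have hs' : Cardinal.lift.{max u v} (Cardinal.mk s) ≤ Cardinal.lift.{w} (Cardinal.mk K) :=
      (Cardinal.lift_lt_aleph0.2 (Cardinal.lt_aleph0_iff_set_finite.2 hs)).le.trans
        (Cardinal.aleph0_le_lift.2 (Cardinal.aleph0_le_mk K))
    obtain ⟨S, hsS, hS⟩ := L.exists_elementarySubstructure_card_eq s (Cardinal.mk K)
      (Cardinal.aleph0_le_mk K) hs' (Cardinal.lift_le.2 hK) h
    obtain ⟨e⟩ := Cardinal.lift_mk_eq'.1 hS
    exact ⟨S, fun k => e.symm k, hsS, (e.symm.surjective.range_comp _).trans Subtype.range_coe⟩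

/-- Otherwise `T` entails the `∀^m ∃^*` sentence saying that over every `m`-tuple there is an
assignment whose pattern of truth values on `A` is one of those not realized over `x` in `M`. The
set `K` of variables need not be finite. -/
lemma exists_modelType_forall_exists_realize_iff {T : L.Theory} {M : Type (max u v w)}
    [L.Structure M] [Nonempty M] {m : ℕ} {K : Type*}
    (hM : ∀ ξ, IsForallExists m ξ → T ⊨ᵇ ξ → M ⊨ ξ) (x : Fin m → M)
    (A : Finset (L.Formula (Fin m ⊕ K))) :
    ∃ (N : Theory.ModelType.{u, v, max u v w} T) (b : Fin m → N), ∀ e : K → N, ∃ g : K → M,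
      ∀ α ∈ A, α.IsQF → (α.Realize (Sum.elim b e) ↔ α.Realize (Sum.elim x g)) := by
  classical
  by_contra! hcon
  let B := {α : L.Formula (Fin m ⊕ K) // α ∈ A ∧ α.IsQF}
  have : Finite B := A.finite_toSet.subset (fun α (h : α ∈ A ∧ α.IsQF) => h.1)
  -- `C` is the set of truth value patterns on `B` that no assignment over `x` in `M` realizes.
  let C := {p : B → Prop // ¬ ∃ g : K → M, ∀ β : B, p β ↔ β.1.Realize (Sum.elim x g)}
  let lit (p : B → Prop) (β : B) : L.Formula (Fin m ⊕ K) := if p β then β.1 else β.1.not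
  let Φ : L.Formula (Fin m ⊕ K) := Formula.iSup fun p : C => Formula.iInf (lit p.1)
  have hΦ : Φ.IsQF := by
    refine isQF_iSup fun p => isQF_iInf fun β => ?_
    dsimp only [lit]
    split_ifs
    · exact β.2.2
    · exact β.2.2.not
  have hr (N : Type (max u v w)) [L.Structure N] (y : Fin m ⊕ K → N) :
      Φ.Realize y ↔ ∃ p : C, ∀ β : B, p.1 β ↔ β.1.Realize y := by
    simp only [Φ, Formula.realize_iSup, Formula.realize_iInf]
    refine exists_congr fun p => forall_congr' fun β => ?_
    by_cases h : p.1 β <;> simp [lit, h, Formula.realize_not]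
  obtain ⟨ξ, hξ, hrξ⟩ := exists_isForallExists_of_isQF.{u, v, max u v w} hΦ
  have hT : T ⊨ᵇ ξ := by
    rw [Theory.models_iff_not_satisfiable]
    rintro ⟨N₀⟩
    let N : Theory.ModelType.{u, v, max u v w} (T ∪ {ξ.not}) := N₀.ulift
    have hN : N ⊨ T ∪ {ξ.not} := N.is_model
    have : N ⊨ T := Theory.Model.mono hN Set.subset_union_left
    refine (Sentence.realize_not N).1 (hN.realize_of_mem ξ.not (.inr rfl)) ((hrξ N).2 fun b => ?_)
    obtain ⟨e, he⟩ := hcon (.of T N) b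
    refine ⟨e, (hr N _).2 ⟨⟨fun β => β.1.Realize (Sum.elim b e), ?_⟩, fun _ => Iff.rfl⟩⟩
    rintro ⟨g, hg⟩
    obtain ⟨α, hα, hqf, h⟩ := he g
    have := hg ⟨α, hα, hqf⟩
    rcases h with h | h
    · exact h.2 (this.1 h.1)
    · exact h.1 (this.2 h.2)
  obtain ⟨g, hg⟩ := (hrξ M).1 (hM ξ hξ hT) x
  obtain ⟨p, hp⟩ := (hr M _).1 hg
  exact p.2 ⟨g, hp⟩

/-- Two assignments of the same variables that satisfy the same quantifier-free formulas induce an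
embedding, provided that the values of the first one form a substructure. -/
lemma exists_embedding_of_realize_iff {P : Type w} {M : Type w'} [L.Structure P] [L.Structure M]
    {J : Type*} {S : L.Substructure P} {E : J → P} {G : J → M} (hE : Set.range E = S)
    (h : ∀ α : L.Formula J, α.IsQF → (α.Realize E ↔ α.Realize G)) :
    ∃ f : S ↪[L] M, ∀ j (hj : E j ∈ S), f ⟨E j, hj⟩ = G j := by
  have hpick (s : S) : ∃ j, E j = s := by
    have : (s : P) ∈ Set.range E := hE ▸ s.2
    exact this
  choose pick hpick using hpick
  have heq (i j : J) : E i = E j ↔ G i = G j := by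
    simpa [Formula.realize_equal] using
      h ((Term.var i).equal (Term.var j)) (.of_isAtomic (.equal _ _))
  refine ⟨{
    toFun := fun s => G (pick s)
    inj' := fun s t hst => Subtype.ext ?_
    map_fun' := fun {n} f y => ?_
    map_rel' := fun {n} r y => ?_ }, fun j hj => (heq _ _).1 (hpick _)⟩
  · rw [← hpick s, ← hpick t]
    exact (heq _ _).2 hst
  · have := h ((Term.func f fun i => Term.var (pick (y i))).equal
      (Term.var (pick (Structure.funMap f y)))) (.of_isAtomic (.equal _ _))
    simp only [Formula.realize_equal, Term.realize_func, Term.realize_var, hpick] at this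
    exact (this.1 rfl).symm
  · have := h (r.formula fun i => Term.var (pick (y i))) (.of_isAtomic (.rel _ _))
    simp only [Formula.realize_rel, Term.realize_var, hpick] at this
    exact this.symm

/-- The model of `T` containing the tuple `x` is a copy of an elementary substructure of an
ultraproduct of models of `T`. The factor at an index `i` is chosen to suit the `i`-th coordinates
of the entries of `x` and the finite set `A i`. -/
lemma exists_substructure_ultrapower {T : L.Theory} {M : Type (max u v w)}
    [L.Structure M] [Nonempty M] {m : ℕ} {K : Type (max u v)} [Infinite K]
    (hK : L.card ≤ Cardinal.mk K)
    (hM : ∀ ξ, IsForallExists m ξ → T ⊨ᵇ ξ → M ⊨ ξ) {I : Type (max u v)} (U : Ultrafilter I)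
    (A : I → Finset (L.Formula (Fin m ⊕ K))) (hA : ∀ α, ∀ᶠ i in U, α ∈ A i)
    (x : Fin m → (U : Filter I).Product fun _ => M) :
    ∃ S : L.Substructure ((U : Filter I).Product fun _ => M),
      (S : Set ((U : Filter I).Product fun _ => M)).Nonempty ∧ S ⊨ T ∧ ∀ l, x l ∈ S := by
  have hx (l : Fin m) : ∃ y : I → M, ((y : I → M) : (U : Filter I).Product fun _ => M) = x l :=
    Quotient.exists_rep (x l)
  choose y hy using hx
  choose N b hN using fun i => exists_modelType_forall_exists_realize_iff.{u, v, w} hM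
    (fun l => y l i) (A i)
  -- The ultraproduct `P` depends on `x`, but the set `K` enumerating the elementary substructure
  -- does not; hence `U` and `A` can be fixed in advance.
  let P := (U : Filter I).Product fun i => N i
  let b' : Fin m → P := fun l => ((fun i => b i l : ∀ i, N i) : P)
  have hPT : P ⊨ T := ⟨fun φ hφ => (Ultraproduct.sentence_realize φ).2
    (.of_forall fun i => Theory.realize_sentence_of_mem T hφ)⟩
  obtain ⟨S, E, hbS, hES⟩ := exists_elementarySubstructure_eq_range (P := P) hK
    (Set.finite_range b')
  have he (k : K) : ∃ e : ∀ i, N i, (e : P) = E k := Quotient.exists_rep (E k)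
  choose e he using he
  -- `E` has coordinates `e k i` in `N i`, and `g i k` is the matching element of `M`.
  choose g hg using fun i => hN i fun k => e k i
  let G : K → (U : Filter I).Product fun _ => M := fun k => ((fun i => g i k : I → M) : _)
  have key (α : L.Formula (Fin m ⊕ K)) (hα : α.IsQF) :
      α.Realize (Sum.elim b' E) ↔ α.Realize (Sum.elim x G) := by
    have h₁ : Sum.elim b' E = fun j =>
        ((Sum.elim (fun l i => b i l) e j : ∀ i, N i) : P) := by
      ext (l | k)
      · rfl
      · exact (he k).symm
    have h₂ : Sum.elim x G = fun j => ((Sum.elim y (fun k i => g i k) j : I → M) :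
        (U : Filter I).Product fun _ => M) := by
      ext (l | k)
      · exact (hy l).symm
      · rfl
    rw [h₁, h₂]
    refine (Ultraproduct.realize_formula_cast α _).trans
      (Iff.trans ?_ (Ultraproduct.realize_formula_cast α _).symm)
    refine eventually_congr ((hA α).mono fun i hi => ?_)
    have h₃ : (fun j => (Sum.elim (fun l i => b i l) e j : ∀ i, N i) i) =
        Sum.elim (b i) fun k => e k i := by ext (l | k) <;> rfl
    have h₄ : (fun j => (Sum.elim y (fun k i => g i k) j : I → M) i) =
        Sum.elim (fun l => y l i) (g i) := by ext (l | k) <;> rfl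
    rw [h₃, h₄]
    exact hg i α hi hα
  have hrange : Set.range (Sum.elim b' E) = (S : L.Substructure P) := by
    rw [Set.Sum.elim_range, hES]
    exact Set.union_eq_right.2 hbS
  obtain ⟨f, hf⟩ := exists_embedding_of_realize_iff hrange key
  have hST : S ⊨ T := (S.theory_model_iff T).2 hPT
  refine ⟨f.toHom.range, ?_, ?_, fun l => ?_⟩
  · have : Nonempty K := inferInstance
    exact ⟨_, ⟨⟨E (Classical.arbitrary K), hES.subset (Set.mem_range_self _)⟩, rfl⟩⟩
  · exact (f.equivRange.toElementaryEmbedding.theory_model_iff T).1 hST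
  · exact ⟨⟨b' l, hbS (Set.mem_range_self l)⟩, hf (.inl l) _⟩

/-- The structure `M'` is an ultrapower of `M`, and the same one serves for tuples of all lengths:
for finitary covers the condition on `M` holds for all positive `m` simultaneously. -/
lemma exists_modelType_forall_exists_substructure {T Z : L.Theory} {ψ : L.Sentence}
    (M : Theory.ModelType.{u, v, max u v} Z) (hψ : ¬ M ⊨ ψ) :
    ∃ M' : Theory.ModelType.{u, v, max u v w} Z, ¬ M' ⊨ ψ ∧
      ∀ m, (∀ ξ, IsForallExists m ξ → T ⊨ᵇ ξ → M ⊨ ξ) → ∀ x : Fin m → M',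
        ∃ S : L.Substructure M', (S : Set M').Nonempty ∧ S ⊨ T ∧ ∀ l, x l ∈ S := by
  classical
  let M₁ : Theory.ModelType.{u, v, max u v w} Z := M.ulift
  let e : M ≃[L] M₁ := (Equiv.ulift.{w, max u v}.symm : M ≃ _).inducedStructureEquiv
  have hM₁ (φ : L.Sentence) : M ⊨ φ ↔ M₁ ⊨ φ := e.toElementaryEmbedding.map_sentence φ
  let K : Type (max u v) := L.Symbols ⊕ ℕ
  have hK : L.card ≤ Cardinal.mk K := Cardinal.mk_le_of_injective Sum.inl_injective
  let I : Type (max u v) := Finset (Σ m, L.Formula (Fin m ⊕ K))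
  let U : Ultrafilter I := Ultrafilter.of atTop
  let P := (U : Filter I).Product fun _ => M₁
  have hP (φ : L.Sentence) : P ⊨ φ ↔ M₁ ⊨ φ := by
    rw [Ultraproduct.sentence_realize, eventually_const]
  have hPZ : P ⊨ Z := ⟨fun φ hφ => (hP φ).2 (Theory.realize_sentence_of_mem Z hφ)⟩
  refine ⟨.of Z P, fun h => hψ ((hM₁ ψ).2 ((hP ψ).1 h)), fun m hm x => ?_⟩
  refine exists_substructure_ultrapower.{u, v, w} hK
    (fun ξ hξ hT => (hM₁ ξ).1 (hm ξ hξ hT)) U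
    (fun i => i.preimage (Sigma.mk (β := fun m => L.Formula (Fin m ⊕ K)) m)
      sigma_mk_injective.injOn) (fun α => ?_) x
  refine Eventually.filter_mono (Ultrafilter.of_le _) ((eventually_ge_atTop {⟨m, α⟩}).mono ?_)
  intro i hi
  simpa using Finset.singleton_subset_iff.1 hi

end CoveredExtension

/-! ### Interpolation -/

open CoveredExtension FirstOrder.Language

theorem mainTheorem8 {L : FirstOrder.Language.{u, v}} (Z T : L.Theory) (ψ : L.Sentence) (k : ℕ) :
    ((∀ (M : Type (max u v w)) [L.Structure M] [Nonempty M] (R : Set (L.Substructure M)),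
        CoveredExtension.IsKAryCover k R → M ⊨ Z → (∀ N ∈ R, N ⊨ Z ∪ T) → M ⊨ ψ) ↔
      ∃ ξ : L.Sentence,
        CoveredExtension.IsForallExists k ξ ∧ CoveredExtension.IsInterpolant Z T ψ ξ) ∧
    ((∀ (M : Type (max u v w)) [L.Structure M] [Nonempty M] (R : Set (L.Substructure M)),
        CoveredExtension.IsFinitaryCover R → M ⊨ Z → (∀ N ∈ R, N ⊨ Z ∪ T) → M ⊨ ψ) ↔
      ∃ ξ : L.Sentence,
        CoveredExtension.IsPiTwo ξ ∧ CoveredExtension.IsInterpolant Z T ψ ξ) := by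
  have sound (k : ℕ) (ξ : L.Sentence) (hξ : IsForallExists k ξ) (hI : IsInterpolant Z T ψ ξ)
      (M : Type (max u v w)) [L.Structure M] [Nonempty M] (R : Set (L.Substructure M))
      (hne : ∀ N ∈ R, (N : Set M).Nonempty)
      (hR : ∀ S : Finset M, S.card ≤ k → ∃ N ∈ R, (S : Set M) ⊆ (N : Set M))
      (hMZ : M ⊨ Z) (hN : ∀ N ∈ R, N ⊨ Z ∪ T) : M ⊨ ψ := by
    refine (Sentence.realize_imp M).1 (hI.2.realize_sentence M)
      (hξ.realize_of_cover hR fun N hNR => ?_)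
    have := hN N hNR
    have := (hne N hNR).to_subtype
    exact hI.1.realize_sentence N
  -- The tuple may have entries outside `S`, so that `S` may be empty.
  have tuple {M : Type (max u v w)} [Nonempty M] {m : ℕ} (S : Finset M) (hS : S.card ≤ m) :
      ∃ x : Fin m → M, (S : Set M) ⊆ Set.range x := by
    have hf := (Fin.castLE_injective hS).comp S.equivFin.injective
    exact ⟨Function.extend _ Subtype.val fun _ => Classical.arbitrary M,
      fun s hs => ⟨_, hf.extend_apply _ _ ⟨s, hs⟩⟩⟩
  refine ⟨⟨fun h => ?_, ?_⟩, ⟨fun h => ?_, ?_⟩⟩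
  · by_contra! hcon
    obtain ⟨M, hMΓ, hMψ⟩ := exists_model_of_forall_not_isInterpolant
      (exists_isForallExists_top k) (fun _ _ => IsForallExists.exists_inf) hcon
    obtain ⟨M', hψ, hcover⟩ := exists_modelType_forall_exists_substructure.{u, v, w}
      (T := Z ∪ T) M hMψ
    have hS (S : Finset M') (hS : S.card ≤ k) :
        ∃ N ∈ {N : L.Substructure M' | (N : Set M').Nonempty ∧ N ⊨ Z ∪ T},
          (S : Set M') ⊆ (N : Set M') := by
      obtain ⟨x, hx⟩ := tuple S hS
      obtain ⟨N, hN, hNT, hxN⟩ := hcover k hMΓ x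
      exact ⟨N, ⟨hN, hNT⟩, hx.trans (Set.range_subset_iff.2 hxN)⟩
    obtain ⟨N₀, hN₀, -⟩ := hS ∅ (by simp)
    exact hψ (h M' _ ⟨⟨N₀, hN₀⟩, fun N hN => hN.1, hS⟩ M'.is_model fun N hN => hN.2)
  · rintro ⟨ξ, hξ, hI⟩ M _ _ R hR
    exact sound k ξ hξ hI M R hR.2.1 hR.2.2
  · by_contra! hcon
    obtain ⟨M, hMΓ, hMψ⟩ := exists_model_of_forall_not_isInterpolant
      exists_isPiTwo_top (fun _ _ => IsPiTwo.exists_inf) hcon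
    obtain ⟨M', hψ, hcover⟩ := exists_modelType_forall_exists_substructure.{u, v, w}
      (T := Z ∪ T) M hMψ
    -- A vacuous existential quantifier turns a `∀^(m+1) ∃^*` sentence into a `Π⁰₂` sentence.
    have hMΓ' (m : ℕ) (ξ : L.Sentence) (hξ : IsForallExists (m + 1) ξ) (hT : (Z ∪ T) ⊨ᵇ ξ) :
        M ⊨ ξ := by
      obtain ⟨Φ, hΦ, hr⟩ := hξ.exists_isQF
      obtain ⟨ξ', hξ', hr'⟩ := exists_isPiTwo_of_isQF hΦ
      refine (hr M).2 ((hr' M).1 (hMΓ ξ' hξ' (Theory.models_sentence_iff.2 fun N => ?_)))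
      exact (hr' N).2 ((hr N).1 (hT.realize_sentence N))
    refine hψ (h M' {N | (N : Set M').Nonempty ∧ N ⊨ Z ∪ T} ⟨fun N hN => hN.1, fun S => ?_⟩
      M'.is_model fun N hN => hN.2)
    obtain ⟨x, hx⟩ := tuple S (Nat.le_succ _)
    obtain ⟨N, hN, hNT, hxN⟩ := hcover _ (hMΓ' _) x
    exact ⟨N, ⟨hN, hNT⟩, hx.trans (Set.range_subset_iff.2 hxN)⟩
  · rintro ⟨ξ, hξ, hI⟩ M _ _ R hR
    obtain ⟨m, hξ⟩ := hξ.exists_isForallExists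
    exact sound _ ξ hξ hI M R hR.1 fun S _ => hR.2 S
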